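/- Let $K\ge 1$ be an integer and let $v\colon\mathbb{Z}\to\mathbb{R}$ be $K$-periodic, i.e. $v(n+K)=v(n)$ for all $n\in\mathbb{Z}$. For $p\in[1,\infty]$ let $H$ be the bounded operator on the complex sequence space $\ell^p(\mathbb{Z})$ given by $(Hx)_n=x_{n+1}+x_{n-1}+v(n)x_n$, and let $H_+$ be its compression to $\ell^p(\mathbb{Z}_+)$, $\mathbb{Z}_+=\{0,1,2,\dots\}$, given by $(H_+x)_n=x_{n+1}+x_{n-1}+v(n)x_n$ for $n\ge 0$, where $x_{-1}:=0$. "Invertible" means having a bounded inverse. Put $$T(n)=\begin{pmatrix}-v(n)&-1\\1&0\end{pmatrix},\qquad M=T(K-1)\cdots T(1)\,T(0)$$ (the monodromy matrix at energy $0$). For every $p\in[1,\infty]$, the operator $H$ is invertible on $\ell^p(\mathbb{Z})$ if and only if $|\operatorname{tr}M|>2$. If this is the case, then $M$ has two real eigenvalues $\lambda_1,\lambda_2$ with $|\lambda_2|<1<|\lambda_1|$, and the following are equivalent: 1. $H_+$ is not injective on $\ell^\infty(\mathbb{Z}_+)$; 2. $H_+$ is not invertible on $\ell^p(\mathbb{Z}_+)$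 for any $p\in[1,\infty]$; 3. $H_+$ is not invertible on $\ell^p(\mathbb{Z}_+)$ for some $p\in[1,\infty]$; 4. $(1,0)^T$ is an eigenvector of $M$ for the eigenvalue $\lambda_2$ of modulus less than $1$; 5. $M_{2,1}=0$ and $|M_{1,1}|<1$. -/

import Mathlib

open scoped ENNReal lp

noncomputable section

namespace PeriodicSchrodinger

theorem memlp_comp {α β : Type*} {p : ℝ≥0∞} {f : α → β} (hf : Function.Injective f)
    {x : β → ℂ} (hx : Memℓp x p) : Memℓp (fun a => x (f a)) p := by
  obtain (rfl | rfl | hp) := p.trichotomy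
  · rw [memℓp_zero_iff] at hx ⊢
    exact hx.preimage hf.injOn
  · rw [memℓp_infty_iff] at hx ⊢
    refine hx.mono ?_
    rintro _ ⟨a, rfl⟩
    exact ⟨f a, rfl⟩
  · rw [memℓp_gen_iff hp] at hx ⊢
    exact hx.comp_injective hf

theorem norm_comp_le {α β : Type*} {p : ℝ≥0∞} [Fact (1 ≤ p)] {f : α → β}
    (hf : Function.Injective f) (x : ℓ^p(β, ℂ)) :
    ‖(⟨fun a => x (f a), memlp_comp hf (lp.memℓp x)⟩ : ℓ^p(α, ℂ))‖ ≤ ‖x‖ := by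
  have hp0 : p ≠ 0 := (zero_lt_one.trans_le (Fact.out : 1 ≤ p)).ne'
  obtain (rfl | rfl | hp) := p.trichotomy
  · exact (hp0 rfl).elim
  · exact lp.norm_le_of_forall_le (norm_nonneg _) fun a => lp.norm_apply_le_norm hp0 x (f a)
  · refine lp.norm_le_of_forall_sum_le hp (norm_nonneg _) fun s => ?_
    have h := lp.sum_rpow_le_norm_rpow hp x (s.map ⟨f, hf⟩)
    simpa using h

/-- Pull-back `x ↦ x ∘ f` along an injective map `f`, as a bounded operator. It provides the shifts
of `ℓ^p(ℤ)` and the restriction `ℓ^p(ℤ) → ℓ^p(ℤ₊)`. -/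
def pullback (p : ℝ≥0∞) [Fact (1 ≤ p)] {α β : Type*} (f : α → β) (hf : Function.Injective f) :
    ℓ^p(β, ℂ) →L[ℂ] ℓ^p(α, ℂ) :=
  LinearMap.mkContinuous
    { toFun := fun x => ⟨fun a => x (f a), memlp_comp hf (lp.memℓp x)⟩
      map_add' := fun _ _ => rfl
      map_smul' := fun _ _ => rfl } 1
    (fun x => by rw [one_mul]; exact norm_comp_le hf x)

@[simp]
theorem pullback_apply (p : ℝ≥0∞) [Fact (1 ≤ p)] {α β : Type*} (f : α → β)
    (hf : Function.Injective f) (x : ℓ^p(β, ℂ)) (a : α) : pullback p f hf x a = x (f a) := rfl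

/-- Extension by zero of a sequence on `ℤ₊ = {0, 1, 2, …}` to a sequence on `ℤ`. -/
def extendZero (x : ℕ → ℂ) (n : ℤ) : ℂ := if 0 ≤ n then x n.toNat else 0

theorem memlp_extendZero {p : ℝ≥0∞} {x : ℕ → ℂ} (hx : Memℓp x p) : Memℓp (extendZero x) p := by
  have hinj : Function.Injective (fun n : ℕ => (n : ℤ)) := Nat.cast_injective
  have hout : ∀ n : ℤ, n ∉ Set.range (fun n : ℕ => (n : ℤ)) → extendZero x n = 0 := by
    intro n hn
    refine if_neg fun h => hn ⟨n.toNat, Int.toNat_of_nonneg h⟩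
  obtain (rfl | rfl | hp) := p.trichotomy
  · rw [memℓp_zero_iff] at hx ⊢
    refine (hx.image (fun n : ℕ => (n : ℤ))).subset fun n hn => ?_
    by_cases h : 0 ≤ n
    · refine ⟨n.toNat, ?_, Int.toNat_of_nonneg h⟩
      simpa [extendZero, h] using hn
    · exact (hn (if_neg h)).elim
  · rw [memℓp_infty_iff] at hx ⊢
    obtain ⟨C, hC⟩ := hx
    refine ⟨max C 0, ?_⟩
    rintro _ ⟨n, rfl⟩
    by_cases h : 0 ≤ n
    · simpa [extendZero, h] using Or.inl (hC ⟨n.toNat, rfl⟩)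
    · simp [extendZero, h]
  · rw [memℓp_gen_iff hp] at hx ⊢
    refine (hinj.summable_iff fun n hn => ?_).1 ?_
    · rw [hout n hn, norm_zero, Real.zero_rpow hp.ne']
    · simpa [Function.comp_def, extendZero] using hx

theorem norm_extendZero_le {p : ℝ≥0∞} [Fact (1 ≤ p)] (x : ℓ^p(ℕ, ℂ)) :
    ‖(⟨extendZero x, memlp_extendZero (lp.memℓp x)⟩ : ℓ^p(ℤ, ℂ))‖ ≤ ‖x‖ := by
  have hp0 : p ≠ 0 := (zero_lt_one.trans_le (Fact.out : 1 ≤ p)).ne'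
  obtain (rfl | rfl | hp) := p.trichotomy
  · exact (hp0 rfl).elim
  · refine lp.norm_le_of_forall_le (norm_nonneg _) fun n => ?_
    by_cases h : 0 ≤ n
    · simpa [extendZero, h] using lp.norm_apply_le_norm hp0 x n.toNat
    · simp [extendZero, h]
  · have hinj : Function.Injective (fun n : ℕ => (n : ℤ)) := Nat.cast_injective
    refine lp.norm_le_of_tsum_le hp (norm_nonneg _) ?_
    rw [lp.norm_rpow_eq_tsum hp x, ← hinj.tsum_eq]
    · simp [extendZero]
    · intro n hn
      by_contra h
      refine hn ?_
      have : extendZero x n = 0 := if_neg fun h' => h ⟨n.toNat, Int.toNat_of_nonneg h'⟩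
      change ‖extendZero x n‖ ^ p.toReal = 0
      rw [this, norm_zero, Real.zero_rpow hp.ne']

/-- The embedding `ℓ^p(ℤ₊) → ℓ^p(ℤ)` by extension by zero. -/
def embed (p : ℝ≥0∞) [Fact (1 ≤ p)] : ℓ^p(ℕ, ℂ) →L[ℂ] ℓ^p(ℤ, ℂ) :=
  LinearMap.mkContinuous
    { toFun := fun x => ⟨extendZero x, memlp_extendZero (lp.memℓp x)⟩
      map_add' := fun x y => by
        apply lp.ext
        funext n
        change extendZero (fun k => x k + y k) n = extendZero x n + extendZero y n
        by_cases h : 0 ≤ n <;> simp [extendZero, h]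
      map_smul' := fun c x => by
        apply lp.ext
        funext n
        by_cases h : 0 ≤ n <;> simp [extendZero, h] } 1
    (fun x => by rw [one_mul]; exact norm_extendZero_le x)

@[simp]
theorem embed_apply (p : ℝ≥0∞) [Fact (1 ≤ p)] (x : ℓ^p(ℕ, ℂ)) (n : ℤ) :
    embed p x n = extendZero x n := rfl

theorem memlp_mul {p : ℝ≥0∞} {v : ℤ → ℝ} (hv : ∃ C, ∀ n, |v n| ≤ C) {x : ℤ → ℂ}
    (hx : Memℓp x p) : Memℓp (fun n => (v n : ℂ) * x n) p := by
  obtain ⟨C, hC⟩ := hv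
  refine (hx.norm.const_mul C).mono fun n => ?_
  rw [norm_mul, Complex.norm_real, Real.norm_eq_abs]
  exact mul_le_mul_of_nonneg_right (hC n) (norm_nonneg _)

/-- Multiplication by a bounded real sequence `v`, as a bounded operator. -/
def mulOp (p : ℝ≥0∞) [Fact (1 ≤ p)] (v : ℤ → ℝ) (hv : ∃ C, ∀ n, |v n| ≤ C) :
    ℓ^p(ℤ, ℂ) →L[ℂ] ℓ^p(ℤ, ℂ) :=
  LinearMap.mkContinuousOfExistsBound
    { toFun := fun x => ⟨fun n => (v n : ℂ) * x n, memlp_mul hv (lp.memℓp x)⟩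
      map_add' := fun x y => by
        apply lp.ext
        funext n
        exact mul_add (v n : ℂ) (x n) (y n)
      map_smul' := fun c x => by
        apply lp.ext
        funext n
        simp [mul_left_comm] }
    (by
      obtain ⟨C, hC⟩ := hv
      have hp0 : p ≠ 0 := (zero_lt_one.trans_le (Fact.out : 1 ≤ p)).ne'
      have hC0 : 0 ≤ C := (abs_nonneg _).trans (hC 0)
      refine ⟨C, fun x => ?_⟩
      have h : ‖(C : ℂ) • x‖ = C * ‖x‖ := by
        rw [norm_smul, Complex.norm_real, Real.norm_eq_abs, abs_of_nonneg hC0]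
      rw [← h]
      refine lp.norm_mono hp0 fun n => ?_
      simp only [LinearMap.coe_mk, AddHom.coe_mk, lp.coeFn_smul, Pi.smul_apply, smul_eq_mul,
        norm_mul, Complex.norm_real, Real.norm_eq_abs, abs_of_nonneg hC0]
      exact mul_le_mul_of_nonneg_right (hC n) (norm_nonneg _))

@[simp]
theorem mulOp_apply (p : ℝ≥0∞) [Fact (1 ≤ p)] (v : ℤ → ℝ) (hv : ∃ C, ∀ n, |v n| ≤ C)
    (x : ℓ^p(ℤ, ℂ)) (n : ℤ) : mulOp p v hv x n = (v n : ℂ) * x n := rfl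

/-- The discrete Schrödinger operator `(H x)_n = x_{n+1} + x_{n-1} + v(n) x_n` on `ℓ^p(ℤ)` with
bounded real potential `v`. -/
def schrodinger (p : ℝ≥0∞) [Fact (1 ≤ p)] (v : ℤ → ℝ) (hv : ∃ C, ∀ n, |v n| ≤ C) :
    ℓ^p(ℤ, ℂ) →L[ℂ] ℓ^p(ℤ, ℂ) :=
  pullback p (fun n => n + 1) (add_left_injective (1 : ℤ))
    + pullback p (fun n => n - 1) (sub_left_injective (b := (1 : ℤ)))
    + mulOp p v hv

theorem schrodinger_apply (p : ℝ≥0∞) [Fact (1 ≤ p)] (v : ℤ → ℝ) (hv : ∃ C, ∀ n, |v n| ≤ C)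
    (x : ℓ^p(ℤ, ℂ)) (n : ℤ) :
    schrodinger p v hv x n = x (n + 1) + x (n - 1) + (v n : ℂ) * x n := rfl

/-- The one-sided compression `H₊` of `H` to `ℓ^p(ℤ₊)`: extend by zero, apply `H`, restrict. -/
def schrodingerPlus (p : ℝ≥0∞) [Fact (1 ≤ p)] (v : ℤ → ℝ) (hv : ∃ C, ∀ n, |v n| ≤ C) :
    ℓ^p(ℕ, ℂ) →L[ℂ] ℓ^p(ℕ, ℂ) :=
  pullback p (fun n : ℕ => (n : ℤ)) Nat.cast_injective ∘L schrodinger p v hv ∘L embed p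

/-- The first row of `H₊`: the Dirichlet condition `x_{-1} = 0`. -/
theorem schrodingerPlus_apply_zero (p : ℝ≥0∞) [Fact (1 ≤ p)] (v : ℤ → ℝ)
    (hv : ∃ C, ∀ n, |v n| ≤ C) (x : ℓ^p(ℕ, ℂ)) :
    schrodingerPlus p v hv x 0 = x 1 + (v 0 : ℂ) * x 0 := by
  simp [schrodingerPlus, schrodinger_apply, extendZero]

/-- The other rows of `H₊`. -/
theorem schrodingerPlus_apply_succ (p : ℝ≥0∞) [Fact (1 ≤ p)] (v : ℤ → ℝ)
    (hv : ∃ C, ∀ n, |v n| ≤ C) (x : ℓ^p(ℕ, ℂ)) (n : ℕ) :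
    schrodingerPlus p v hv x (n + 1) = x (n + 2) + x n + (v (n + 1) : ℂ) * x (n + 1) := by
  have h1 : (0 : ℤ) ≤ (n : ℤ) + 1 + 1 := by positivity
  have h2 : (0 : ℤ) ≤ (n : ℤ) + 1 := by positivity
  have h3 : ((n : ℤ) + 1 + 1).toNat = n + 2 := by omega
  simp [schrodingerPlus, schrodinger_apply, extendZero, h1, h2, h3]

theorem bounded_of_periodic {v : ℤ → ℝ} {K : ℕ} (hK : 0 < K)
    (hv : Function.Periodic v (K : ℤ)) : ∃ C, ∀ n, |v n| ≤ C := by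
  have hK' : (0 : ℤ) < K := by exact_mod_cast hK
  refine ⟨∑ i ∈ Finset.range K, |v i|, fun n => ?_⟩
  have h0 : 0 ≤ n % (K : ℤ) := Int.emod_nonneg _ hK'.ne'
  have h1 : n % (K : ℤ) < K := Int.emod_lt_of_pos _ hK'
  have h2 : v n = v ((n % (K : ℤ)).toNat : ℤ) := by
    rw [Int.toNat_of_nonneg h0]
    conv_lhs => rw [← Int.emod_add_mul_ediv n K, mul_comm]
    exact hv.int_mul (n / K) _
  rw [h2]
  exact Finset.single_le_sum (f := fun i : ℕ => |v i|) (fun _ _ => abs_nonneg _)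
    (Finset.mem_range.2 (by omega))

/-- The transfer matrix `T(n, E)`. -/
def transferMatrix (v : ℤ → ℝ) (E : ℝ) (n : ℤ) : Matrix (Fin 2) (Fin 2) ℝ :=
  !![E - v n, -1; 1, 0]

/-- The product `T(K-1, E) ⋯ T(1, E) T(0, E)`; for a `K`-periodic potential `v` this is the
monodromy matrix `M(E)`. -/
def monodromy (v : ℤ → ℝ) (E : ℝ) : ℕ → Matrix (Fin 2) (Fin 2) ℝ
  | 0 => 1
  | k + 1 => transferMatrix v E k * monodromy v E k

end PeriodicSchrodinger

end

open PeriodicSchrodinger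

/-!
Solve `H φ = 0` as a second-order recurrence, with no summability required. If `λ` is an eigenvalue
of `M`, there is a Floquet solution with `φ(n+K) = λ φ(n)`, and since `det M = 1` the eigenvalues
are `λ` and `λ⁻¹` with `λ + λ⁻¹ = tr M`.

If `|tr M| ≤ 2`, then `|λ| = 1` and the Floquet solution is bounded; damping it by `(1+δ)^(-|n|)`
puts it into every `ℓ^p` and changes `H φ` only by `O(δ)`, so `H` is not bounded below. If
`|tr M| > 2`, there are solutions decaying exponentially at `-∞` and at `+∞`, whose Casoratian is a
nonzero constant; their Green kernel inverts `H`.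

On the half-line everything is decided by the value at `-1` of the solution `ψ` decaying at `+∞`. If
`ψ(-1) = 0`, then `ψ` restricts to a null vector of `H₊`. Otherwise the Casoratian with `ψ` shows
that `H₊` is injective, and a solution of `H z = y` corrected by a multiple of `ψ` vanishes at `-1`,
so `H₊` is surjective. Finally `ψ(-1) = 0` says that the initial data of `ψ`, an eigenvector of `M`,
is proportional to `(1, 0)`.
-/

namespace PeriodicSchrodinger

open Filter Topology
open scoped Matrix

section Lp

variable {α : Type*} {p : ℝ≥0∞} [Fact (1 ≤ p)]

theorem lp_norm_le_mul_norm {x y : ℓ^p(α, ℂ)} {C : ℝ} (hC : 0 ≤ C)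
    (h : ∀ a, ‖x a‖ ≤ C * ‖y a‖) : ‖x‖ ≤ C * ‖y‖ := by
  have hp : p ≠ 0 := (zero_lt_one.trans_le Fact.out).ne'
  have hnorm : ∀ z : ℂ, ‖(C : ℂ) * z‖ = C * ‖z‖ := fun z => by
    rw [norm_mul, Complex.norm_real, Real.norm_of_nonneg hC]
  calc ‖x‖ ≤ ‖(C : ℂ) • y‖ := lp.norm_mono hp fun a => (h a).trans_eq (hnorm (y a)).symm
    _ = C * ‖y‖ := by rw [norm_smul, Complex.norm_real, Real.norm_of_nonneg hC]

theorem lp_norm_le_norm_add_norm {x y z : ℓ^p(α, ℂ)} (h : ∀ a, ‖x a‖ ≤ ‖y a‖ + ‖z a‖) :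
    ‖x‖ ≤ ‖y‖ + ‖z‖ := by
  have hp : p ≠ 0 := (zero_lt_one.trans_le Fact.out).ne'
  let modulus (w : ℓ^p(α, ℂ)) : ℓ^p(α, ℝ) := ⟨fun a => ‖w a‖, (lp.memℓp w).norm⟩
  have hmodulus : ∀ w, ‖modulus w‖ ≤ ‖w‖ := fun w => lp.norm_mono hp fun a => (norm_norm (w a)).le
  calc ‖x‖ ≤ ‖modulus y + modulus z‖ := lp.norm_mono hp fun a => (h a).trans (le_abs_self _)
    _ ≤ ‖y‖ + ‖z‖ := norm_add_le_of_le (hmodulus y) (hmodulus z)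

theorem memlp_of_summable_norm {x : α → ℂ} (hx : Summable fun a => ‖x a‖) : Memℓp x p :=
  Memℓp.of_exponent_ge (q := 1) (memℓp_gen (by simpa using hx)) Fact.out

theorem exists_lp_hasSum_kernel {ι : Type*} [AddCommGroup ι] {g : ι → ι → ℂ} {b : ι → ℝ}
    (hb : Summable b) (hg : ∀ k n, ‖g n (n + k)‖ ≤ b k) (y : ℓ^p(ι, ℂ)) :
    ∃ x : ℓ^p(ι, ℂ), ∀ n, HasSum (fun m => g n m * y m) (x n) := by
  let shift (k : ι) : ℓ^p(ι, ℂ) := pullback p (· + k) (add_left_injective k) y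
  have hle : ∀ k n, ‖g n (n + k) * shift k n‖ ≤ b k * ‖shift k n‖ := fun k n => by
    rw [norm_mul]
    exact mul_le_mul_of_nonneg_right (hg k n) (norm_nonneg _)
  let diagonal (k : ι) : ℓ^p(ι, ℂ) :=
    ⟨fun n => g n (n + k) * shift k n, ((lp.memℓp (shift k)).norm.const_mul (b k)).mono (hle k)⟩
  have hdiagonal : Summable diagonal := by
    refine Summable.of_norm_bounded (hb.mul_right ‖y‖) fun k => ?_
    have hbk : 0 ≤ b k := (norm_nonneg _).trans (hg k 0)
    exact (lp_norm_le_mul_norm hbk (hle k)).trans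
      (mul_le_mul_of_nonneg_left (norm_comp_le (add_left_injective k) y) hbk)
  refine ⟨∑' k, diagonal k, fun n => (Equiv.addLeft n).hasSum_iff.1 ?_⟩
  exact (lp.evalCLM ℂ (fun _ : ι => ℂ) p n).hasSum hdiagonal.hasSum

end Lp

section DifferenceEquation

variable {v : ℤ → ℝ} {φ ψ : ℤ → ℂ}

/-- The difference expression `φ(n+1) + φ(n-1) + v(n) φ(n)` of the operator `H`, for an arbitrary
sequence `φ`, with no summability or boundedness required. -/
def diffExpr (v : ℤ → ℝ) (φ : ℤ → ℂ) (n : ℤ) : ℂ :=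
  φ (n + 1) + φ (n - 1) + (v n : ℂ) * φ n

/-- `φ` is a (formal) solution of `H φ = 0` on all of `ℤ`. -/
def IsSolution (v : ℤ → ℝ) (φ : ℤ → ℂ) : Prop :=
  ∀ n, diffExpr v φ n = 0

/-- The initial data `(φ(n), φ(n-1))` at the site `n`, ordered so that the transfer matrix
`T(n)` carries it to the site `n + 1`. -/
def initialData (φ : ℤ → ℂ) (n : ℤ) : Fin 2 → ℂ :=
  ![φ n, φ (n - 1)]

/-- The Casoratian (discrete Wronskian) `φ(n-1) ψ(n) - φ(n) ψ(n-1)` of two sequences. -/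
def casoratian (φ ψ : ℤ → ℂ) (n : ℤ) : ℂ :=
  φ (n - 1) * ψ n - φ n * ψ (n - 1)

theorem IsSolution.const_mul (hφ : IsSolution v φ) (c : ℂ) : IsSolution v fun n => c * φ n :=
  fun n => by
    have h := hφ n
    simp only [diffExpr] at h ⊢
    linear_combination c * h

theorem IsSolution.comp_add_period {K : ℤ} (hφ : IsSolution v φ) (hv : Function.Periodic v K) :
    IsSolution v fun n => φ (n + K) := fun n => by
  have h := hφ (n + K)
  rwa [diffExpr, hv n, add_right_comm n, add_sub_right_comm n] at h

theorem eq_zero_of_diffExpr_eq_zero_of_nonneg (hφ : ∀ n, 0 ≤ n → diffExpr v φ n = 0)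
    (h0 : φ 0 = 0) (h1 : φ (-1) = 0) (n : ℕ) : φ n = 0 := by
  suffices h : φ n = 0 ∧ φ (n - 1) = 0 from h.1
  induction n with
  | zero => exact ⟨h0, h1⟩
  | succ n ih =>
    have h := hφ n n.cast_nonneg
    rw [diffExpr, ih.1, ih.2, mul_zero, add_zero, add_zero] at h
    exact ⟨by exact_mod_cast h, by simpa using ih.1⟩

theorem IsSolution.eq_zero (hφ : IsSolution v φ) (h0 : φ 0 = 0) (h1 : φ (-1) = 0) : φ = 0 := by
  -- The reflection `n ↦ -1 - n` exchanges the two initial sites.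
  have hreflect : ∀ n, diffExpr (fun n => v (-1 - n)) (fun n => φ (-1 - n)) n = 0 := fun n => by
    have h := hφ (-1 - n)
    rw [diffExpr, add_comm (φ _)] at h
    rwa [diffExpr, ← sub_sub, sub_sub_eq_add_sub, add_sub_right_comm]
  funext n
  obtain ⟨k, rfl | rfl⟩ : ∃ k : ℕ, n = k ∨ n = -1 - k := ⟨(max n (-1 - n)).toNat, by omega⟩
  · exact eq_zero_of_diffExpr_eq_zero_of_nonneg (fun n _ => hφ n) h0 h1 k
  · exact eq_zero_of_diffExpr_eq_zero_of_nonneg (fun n _ => hreflect n) h1 h0 k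

theorem IsSolution.eq_of_initialData_eq (hφ : IsSolution v φ) (hψ : IsSolution v ψ)
    (h : initialData φ 0 = initialData ψ 0) : φ = ψ := by
  have hsub : IsSolution v (φ - ψ) := fun n => by
    have h1 := hφ n
    have h2 := hψ n
    simp only [diffExpr, Pi.sub_apply] at h1 h2 ⊢
    linear_combination h1 - h2
  exact sub_eq_zero.1 (hsub.eq_zero (sub_eq_zero.2 (congrFun h 0)) (sub_eq_zero.2 (congrFun h 1)))

theorem exists_orbit_int {α : Type*} (f : ℤ → α ≃ α) (a : α) :
    ∃ u : ℤ → α, u 0 = a ∧ ∀ n, u (n + 1) = f n (u n) := by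
  let u (n : ℤ) : α :=
    Int.inductionOn' (motive := fun _ => α) n 0 a (fun k _ => f k) (fun k _ => (f (k - 1)).symm)
  refine ⟨u, Int.inductionOn'_self, fun n => ?_⟩
  rcases le_or_gt 0 n with hn | hn
  · exact Int.inductionOn'_add_one hn
  · have h : u (n + 1 - 1) = (f (n + 1 - 1)).symm (u (n + 1)) := Int.inductionOn'_sub_one hn
    rw [add_sub_cancel_right] at h
    rw [h, Equiv.apply_symm_apply]

theorem exists_isSolution_initialData_eq (v : ℤ → ℝ) (w : Fin 2 → ℂ) :
    ∃ φ, IsSolution v φ ∧ initialData φ 0 = w := by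
  let step (n : ℤ) : ℂ × ℂ ≃ ℂ × ℂ :=
    { toFun := fun a => (-(v n : ℂ) * a.1 - a.2, a.1)
      invFun := fun a => (a.2, -(v n : ℂ) * a.2 - a.1)
      left_inv := fun a => by simp
      right_inv := fun a => by simp }
  obtain ⟨u, hu0, hu⟩ := exists_orbit_int step (w 0, w 1)
  have hsnd : ∀ n, (u (n - 1)).1 = (u n).2 := fun n => by
    have h := hu (n - 1)
    rw [sub_add_cancel] at h
    rw [h, Equiv.coe_fn_mk]
  refine ⟨fun n => (u n).1, fun n => ?_, ?_⟩
  · rw [diffExpr, hsnd, hu]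
    simp only [step, Equiv.coe_fn_mk]
    ring
  · simp only [initialData, hsnd, hu0]
    ext i
    fin_cases i <;> rfl

theorem IsSolution.initialData_natCast (hφ : IsSolution v φ) (k : ℕ) :
    initialData φ k = (monodromy v 0 k).map (algebraMap ℝ ℂ) *ᵥ initialData φ 0 := by
  induction k with
  | zero => simp [monodromy]
  | succ k ih =>
    rw [monodromy, Matrix.map_mul, ← Matrix.mulVec_mulVec, ← ih]
    have hrec : φ (k + 1) = -(v k * φ k) + -φ (k - 1) := by
      have h := hφ k
      rw [diffExpr] at h
      linear_combination h
    ext i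
    fin_cases i <;>
      simp [initialData, transferMatrix, Matrix.mulVec, dotProduct, Fin.sum_univ_two, hrec]

theorem casoratian_add_one_sub (v : ℤ → ℝ) (φ ψ : ℤ → ℂ) (n : ℤ) :
    casoratian φ ψ (n + 1) - casoratian φ ψ n = φ n * diffExpr v ψ n - ψ n * diffExpr v φ n := by
  simp only [casoratian, diffExpr, add_sub_cancel_right]
  ring

theorem casoratian_eq_of_nonneg (hφ : ∀ n, 0 ≤ n → diffExpr v φ n = 0)
    (hψ : ∀ n, 0 ≤ n → diffExpr v ψ n = 0) {n : ℤ} (hn : 0 ≤ n) :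
    casoratian φ ψ n = casoratian φ ψ 0 := by
  induction n, hn using Int.leInduction with
  | base => rfl
  | succ n hn ih =>
    rw [← ih, ← sub_eq_zero, casoratian_add_one_sub v, hφ n hn, hψ n hn, mul_zero, mul_zero,
      sub_zero]

theorem IsSolution.casoratian_eq (hφ : IsSolution v φ) (hψ : IsSolution v ψ) (n : ℤ) :
    casoratian φ ψ n = casoratian φ ψ 0 := by
  have hperiodic : Function.Periodic (casoratian φ ψ) 1 := fun n => by
    rw [← sub_eq_zero, casoratian_add_one_sub v, hφ n, hψ n, mul_zero, mul_zero, sub_zero]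
  simpa using hperiodic.int_mul_eq n

theorem IsSolution.exists_eq_const_mul (hφ : IsSolution v φ) (hψ : IsSolution v ψ) (hψ0 : ψ ≠ 0)
    (h : casoratian φ ψ 0 = 0) : ∃ c : ℂ, φ = fun n => c * ψ n := by
  rw [casoratian, zero_sub, sub_eq_zero] at h
  have hdata : ψ 0 ≠ 0 ∨ ψ (-1) ≠ 0 := by
    by_contra! hzero
    exact hψ0 (hψ.eq_zero hzero.1 hzero.2)
  suffices hc : ∃ c : ℂ, φ 0 = c * ψ 0 ∧ φ (-1) = c * ψ (-1) by
    obtain ⟨c, h0, h1⟩ := hc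
    refine ⟨c, hφ.eq_of_initialData_eq (hψ.const_mul c) ?_⟩
    simp only [initialData, zero_sub, h0, h1]
  rcases hdata with h0 | h1
  · exact ⟨φ 0 / ψ 0, by field_simp, by field_simp; exact h⟩
  · exact ⟨φ (-1) / ψ (-1), by field_simp; exact h.symm, by field_simp⟩

theorem casoratian_eq_zero_of_tendsto_zero {l : Filter ℤ} [l.NeBot] {B : ℝ}
    (hφ : ∀ n, ‖φ n‖ ≤ B) (hψ : Tendsto ψ l (𝓝 0)) (hψ' : Tendsto (fun n => ψ (n - 1)) l (𝓝 0))
    (hconst : ∀ᶠ n in l, casoratian φ ψ n = casoratian φ ψ 0) : casoratian φ ψ 0 = 0 := by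
  have hbdd : ∀ f : ℤ → ℤ, IsBoundedUnder (· ≤ ·) l (norm ∘ fun n => φ (f n)) := fun f =>
    isBoundedUnder_of ⟨B, fun n => hφ (f n)⟩
  have hlim : Tendsto (casoratian φ ψ) l (𝓝 (0 - 0)) :=
    (isBoundedUnder_le_mul_tendsto_zero (hbdd (· - 1)) hψ).sub
      (isBoundedUnder_le_mul_tendsto_zero (hbdd id) hψ')
  rw [sub_zero] at hlim
  exact tendsto_nhds_unique (tendsto_const_nhds.congr' (hconst.mono fun _ h => h.symm)) hlim

end DifferenceEquation

section WholeLine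

variable {p : ℝ≥0∞} [Fact (1 ≤ p)] {v : ℤ → ℝ} {hv : ∃ C, ∀ n, |v n| ≤ C} {φ ψ : ℤ → ℂ}

theorem IsSolution.schrodinger_injective (hφ : IsSolution v φ) (hψ : IsSolution v ψ)
    (hφ_lim : Tendsto φ atBot (𝓝 0)) (hψ_lim : Tendsto ψ atTop (𝓝 0))
    (hcas : casoratian φ ψ 0 ≠ 0) : Function.Injective (schrodinger p v hv) := by
  rw [injective_iff_map_eq_zero]
  intro x hx
  have hp : p ≠ 0 := (zero_lt_one.trans_le Fact.out).ne'
  have hx_sol : IsSolution v x := fun n => congrFun (congrArg Subtype.val hx) n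
  have hcas_φ : casoratian x φ 0 = 0 :=
    casoratian_eq_zero_of_tendsto_zero (lp.norm_apply_le_norm hp x) hφ_lim
      (hφ_lim.comp (tendsto_atBot_add_const_right atBot (-1) tendsto_id))
      (Eventually.of_forall (hx_sol.casoratian_eq hφ))
  have hcas_ψ : casoratian x ψ 0 = 0 :=
    casoratian_eq_zero_of_tendsto_zero (lp.norm_apply_le_norm hp x) hψ_lim
      (hψ_lim.comp (tendsto_atTop_add_const_right atTop (-1) tendsto_id))
      (Eventually.of_forall (hx_sol.casoratian_eq hψ))
  simp only [casoratian, zero_sub] at hcas hcas_φ hcas_ψ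
  have h0 : x 0 = 0 := (mul_eq_zero_iff_right hcas).1 <| by
    linear_combination φ 0 * hcas_ψ - ψ 0 * hcas_φ
  have h1 : x (-1) = 0 := (mul_eq_zero_iff_right hcas).1 <| by
    linear_combination φ (-1) * hcas_ψ - ψ (-1) * hcas_φ
  exact lp.ext (hx_sol.eq_zero h0 h1)

/-- The Green kernel `φ(min(n,m)) ψ(max(n,m)) / W` of two solutions with Casoratian `W`, the
integral kernel of `H⁻¹` when `φ` decays at `-∞` and `ψ` decays at `+∞`. -/
noncomputable def greenKernel (φ ψ : ℤ → ℂ) (n m : ℤ) : ℂ :=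
  φ (min n m) * ψ (max n m) / casoratian φ ψ 0

theorem diffExpr_greenKernel (hφ : IsSolution v φ) (hψ : IsSolution v ψ)
    (hcas : casoratian φ ψ 0 ≠ 0) (n m : ℤ) :
    diffExpr v (greenKernel φ ψ · m) n = if m = n then 1 else 0 := by
  have hφn := hφ n
  have hψn := hψ n
  have hconst := hφ.casoratian_eq hψ n
  simp only [diffExpr] at hφn hψn
  simp only [diffExpr, greenKernel]
  rcases lt_trichotomy n m with h | rfl | h
  · rw [if_neg h.ne', min_eq_left (by omega), min_eq_left (by omega), min_eq_left h.le,
      max_eq_right (by omega), max_eq_right (by omega), max_eq_right h.le]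
    linear_combination ψ m / casoratian φ ψ 0 * hφn
  · rw [if_pos rfl, min_eq_right (by omega), min_eq_left (by omega), min_self,
      max_eq_left (by omega), max_eq_right (by omega), max_self, ← div_self hcas]
    nth_rw 4 [← hconst]
    rw [casoratian.eq_def φ ψ n]
    linear_combination φ n / casoratian φ ψ 0 * hψn
  · rw [if_neg h.ne, min_eq_right (by omega), min_eq_right (by omega), min_eq_right h.le,
      max_eq_left (by omega), max_eq_left (by omega), max_eq_left h.le]
    linear_combination φ m / casoratian φ ψ 0 * hψn

theorem norm_greenKernel_le {ρ C D : ℝ} (hρ : 0 < ρ) (hφ : ∀ n, ‖φ n‖ ≤ C * ρ ^ (-n))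
    (hψ : ∀ n, ‖ψ n‖ ≤ D * ρ ^ n) (k n : ℤ) :
    ‖greenKernel φ ψ n (n + k)‖ ≤ C * D / ‖casoratian φ ψ 0‖ * ρ ^ |k| := by
  have hexp : |k| = -min n (n + k) + max n (n + k) := by rw [abs_eq_max_neg]; omega
  rw [greenKernel, norm_div, norm_mul, div_mul_eq_mul_div]
  refine div_le_div_of_nonneg_right ?_ (norm_nonneg _)
  calc ‖φ (min n (n + k))‖ * ‖ψ (max n (n + k))‖
      ≤ C * ρ ^ (-min n (n + k)) * (D * ρ ^ max n (n + k)) :=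
        mul_le_mul (hφ _) (hψ _) (norm_nonneg _) ((norm_nonneg _).trans (hφ _))
    _ = C * D * ρ ^ |k| := by rw [hexp, zpow_add₀ hρ.ne']; ring

theorem summable_zpow_abs {ρ : ℝ} (hρ : 0 ≤ ρ) (hρ1 : ρ < 1) : Summable fun n : ℤ => ρ ^ |n| := by
  refine Summable.of_nat_of_neg ?_ ?_ <;> simpa using summable_geometric_of_lt_one hρ hρ1

theorem IsSolution.schrodinger_surjective {ρ C D : ℝ} (hφ : IsSolution v φ) (hψ : IsSolution v ψ)
    (hρ : 0 < ρ) (hρ1 : ρ < 1) (hφ_le : ∀ n, ‖φ n‖ ≤ C * ρ ^ (-n))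
    (hψ_le : ∀ n, ‖ψ n‖ ≤ D * ρ ^ n) (hcas : casoratian φ ψ 0 ≠ 0) :
    Function.Surjective (schrodinger p v hv) := fun y => by
  obtain ⟨x, hx⟩ := exists_lp_hasSum_kernel
    ((summable_zpow_abs hρ.le hρ1).mul_left (C * D / ‖casoratian φ ψ 0‖))
    (norm_greenKernel_le hρ hφ_le hψ_le) y
  refine ⟨x, lp.ext (funext fun n => ?_)⟩
  have hsum : HasSum (fun m => diffExpr v (greenKernel φ ψ · m) n * y m)
      (schrodinger p v hv x n) := by
    rw [schrodinger_apply]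
    convert ((hx (n + 1)).add (hx (n - 1))).add ((hx n).mul_left (v n : ℂ)) using 2 with m
    rw [diffExpr]
    ring
  simp only [diffExpr_greenKernel hφ hψ hcas, ite_mul, one_mul, zero_mul] at hsum
  exact hsum.unique (by simpa using hasSum_single n fun m hm => if_neg hm)

theorem summable_norm_natCast_of_norm_le_zpow {ρ D : ℝ} (hρ : 0 ≤ ρ) (hρ1 : ρ < 1)
    (hψ : ∀ n, ‖ψ n‖ ≤ D * ρ ^ n) : Summable fun n : ℕ => ‖ψ n‖ :=
  Summable.of_nonneg_of_le (fun _ => norm_nonneg _) (fun n => hψ n) <| by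
    simpa using (summable_geometric_of_lt_one hρ hρ1).mul_left D

theorem tendsto_atTop_zero_of_summable_norm (hψ : Summable fun n : ℕ => ‖ψ n‖) :
    Tendsto ψ atTop (𝓝 0) := by
  rw [← Nat.map_cast_int_atTop, tendsto_map'_iff]
  exact tendsto_zero_iff_norm_tendsto_zero.2 hψ.tendsto_atTop_zero

theorem IsSolution.isUnit_schrodinger {ρ C D : ℝ} (hφ : IsSolution v φ) (hψ : IsSolution v ψ)
    (hρ : 0 < ρ) (hρ1 : ρ < 1) (hφ_le : ∀ n, ‖φ n‖ ≤ C * ρ ^ (-n))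
    (hψ_le : ∀ n, ‖ψ n‖ ≤ D * ρ ^ n) (hcas : casoratian φ ψ 0 ≠ 0) :
    IsUnit (schrodinger p v hv) := by
  have hψ_lim : Tendsto ψ atTop (𝓝 0) := tendsto_atTop_zero_of_summable_norm <|
    summable_norm_natCast_of_norm_le_zpow hρ.le hρ1 hψ_le
  have hφ_neg_le : ∀ n, ‖(φ ∘ Neg.neg) n‖ ≤ C * ρ ^ n := fun n => by
    exact (hφ_le (-n)).trans_eq (by rw [neg_neg])
  have hφ_neg_lim : Tendsto (φ ∘ Neg.neg) atTop (𝓝 0) := tendsto_atTop_zero_of_summable_norm <|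
    summable_norm_natCast_of_norm_le_zpow hρ.le hρ1 hφ_neg_le
  have hφ_lim : Tendsto φ atBot (𝓝 0) := by
    simpa only [Function.comp_assoc, Function.comp_def, neg_neg] using
      hφ_neg_lim.comp tendsto_neg_atBot_atTop
  exact ContinuousLinearMap.isUnit_iff_bijective.2
    ⟨hφ.schrodinger_injective hψ hφ_lim hψ_lim hcas,
      hφ.schrodinger_surjective hψ hρ hρ1 hφ_le hψ_le hcas⟩

theorem abs_one_sub_zpow_le {r : ℝ} (hr : 1 ≤ r) {k : ℤ} (hk : |k| ≤ 1) : |1 - r ^ k| ≤ r - 1 := by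
  have : 0 < r := one_pos.trans_le hr
  have hk' := abs_le.1 hk
  obtain rfl | rfl | rfl : k = -1 ∨ k = 0 ∨ k = 1 := by omega
  · have hinv : r⁻¹ ≤ 1 := inv_le_one_of_one_le₀ hr
    have hfactor : 1 - r⁻¹ = (r - 1) * r⁻¹ := by field_simp
    rw [zpow_neg_one, abs_of_nonneg (sub_nonneg.2 hinv), hfactor]
    exact mul_le_of_le_one_right (sub_nonneg.2 hr) hinv
  · simpa using hr
  · rw [zpow_one, abs_sub_comm, abs_of_nonneg (sub_nonneg.2 hr)]

/-- The damped sequence `(1+δ)^(-|n|) x(n)`: a bounded solution `x` becomes an approximate null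
vector of `H` that lies in every `ℓ^p(ℤ)`. -/
noncomputable def damped (δ : ℝ) (x : ℤ → ℂ) (n : ℤ) : ℂ :=
  (((1 + δ) ^ (-|n|) : ℝ) : ℂ) * x n

theorem memlp_damped {δ B : ℝ} {x : ℤ → ℂ} (hδ : 0 < δ) (hx : ∀ n, ‖x n‖ ≤ B) :
    Memℓp (damped δ x) p := by
  have hweight : Summable fun n : ℤ => (1 + δ) ^ (-|n|) := by
    simpa only [inv_zpow'] using
      summable_zpow_abs (inv_nonneg.2 (by positivity)) (inv_lt_one_of_one_lt₀ (by linarith))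
  refine memlp_of_summable_norm <|
    Summable.of_nonneg_of_le (fun _ => norm_nonneg _) (fun n => ?_) (hweight.mul_right B)
  rw [damped, norm_mul, Complex.norm_real, Real.norm_of_nonneg (by positivity)]
  exact mul_le_mul_of_nonneg_left (hx n) (by positivity)

theorem IsSolution.norm_diffExpr_damped_le {δ : ℝ} {x : ℤ → ℂ} (hδ : 0 ≤ δ) (hx : IsSolution v x)
    (n : ℤ) : ‖diffExpr v (damped δ x) n‖ ≤
      δ * ‖damped δ x (n + 1)‖ + δ * ‖damped δ x (n - 1)‖ := by
  have hr : 0 < 1 + δ := by positivity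
  let defect (m : ℤ) : ℝ := 1 - (1 + δ) ^ (|m| - |n|)
  have hdefect : ∀ m, |m - n| ≤ 1 → |defect m| ≤ δ := fun m hm => by
    simpa using abs_one_sub_zpow_le (le_add_of_nonneg_right hδ) ((abs_abs_sub_abs_le m n).trans hm)
  have hmul : ∀ m, ((defect m : ℝ) : ℂ) * damped δ x m =
      (((1 + δ) ^ (-|m|) - (1 + δ) ^ (-|n|) : ℝ) : ℂ) * x m := fun m => by
    rw [damped, ← mul_assoc, ← Complex.ofReal_mul, sub_mul, one_mul, ← zpow_add₀ hr.ne']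
    congr 4
    ring
  have hdiff : diffExpr v (damped δ x) n =
      defect (n + 1) * damped δ x (n + 1) + defect (n - 1) * damped δ x (n - 1) := by
    have h := hx n
    rw [diffExpr] at h
    rw [hmul, hmul, diffExpr, damped, damped, damped]
    push_cast
    linear_combination (1 + δ : ℂ) ^ (-|n|) * h
  rw [hdiff]
  refine (norm_add_le _ _).trans (add_le_add ?_ ?_) <;>
  · rw [norm_mul, Complex.norm_real]
    exact mul_le_mul_of_nonneg_right (hdefect _ (by simp)) (norm_nonneg _)

theorem IsSolution.exists_norm_schrodinger_le {δ B : ℝ} {x : ℤ → ℂ} (hδ : 0 < δ)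
    (hx : IsSolution v x) (hx0 : x ≠ 0) (hxB : ∀ n, ‖x n‖ ≤ B) :
    ∃ y : ℓ^p(ℤ, ℂ), y ≠ 0 ∧ ‖schrodinger p v hv y‖ ≤ 2 * δ * ‖y‖ := by
  let y : ℓ^p(ℤ, ℂ) := ⟨damped δ x, memlp_damped hδ hxB⟩
  have hy : y ≠ 0 := fun h => by
    obtain ⟨n, hn⟩ := Function.ne_iff.1 hx0
    have hweight : (((1 + δ) ^ (-|n|) : ℝ) : ℂ) ≠ 0 := Complex.ofReal_ne_zero.2 (by positivity)
    exact mul_ne_zero hweight hn (congrFun (congrArg Subtype.val h) n)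
  let right : ℓ^p(ℤ, ℂ) := pullback p (· + 1) (add_left_injective 1) y
  let left : ℓ^p(ℤ, ℂ) := pullback p (· - 1) sub_left_injective y
  have hscale : ∀ z : ℓ^p(ℤ, ℂ), ‖z‖ ≤ ‖y‖ → ‖(δ : ℂ) • z‖ ≤ δ * ‖y‖ := fun z hz => by
    rw [norm_smul, Complex.norm_real, Real.norm_of_nonneg hδ.le]
    exact mul_le_mul_of_nonneg_left hz hδ.le
  refine ⟨y, hy, ?_⟩
  calc ‖schrodinger p v hv y‖ ≤ ‖(δ : ℂ) • right‖ + ‖(δ : ℂ) • left‖ :=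
        lp_norm_le_norm_add_norm fun n => by
          rw [lp.coeFn_smul, lp.coeFn_smul, Pi.smul_apply, Pi.smul_apply, norm_smul, norm_smul,
            Complex.norm_real, Real.norm_of_nonneg hδ.le]
          exact hx.norm_diffExpr_damped_le hδ.le n
    _ ≤ δ * ‖y‖ + δ * ‖y‖ := add_le_add
        (hscale right (norm_comp_le (add_left_injective 1) y))
        (hscale left (norm_comp_le sub_left_injective y))
    _ = 2 * δ * ‖y‖ := by ring

theorem IsSolution.not_isUnit_schrodinger {B : ℝ} {x : ℤ → ℂ} (hx : IsSolution v x) (hx0 : x ≠ 0)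
    (hxB : ∀ n, ‖x n‖ ≤ B) : ¬ IsUnit (schrodinger p v hv) := by
  rintro ⟨H, hH⟩
  obtain ⟨C, hC⟩ : ∃ C : NNReal, ∀ y, ‖y‖ ≤ C * ‖schrodinger p v hv y‖ :=
    ⟨_, hH ▸ (H : ℓ^p(ℤ, ℂ) →L[ℂ] ℓ^p(ℤ, ℂ)).bound_of_antilipschitz
      (ContinuousLinearEquiv.ofUnit H).antilipschitz⟩
  obtain ⟨y, hy0, hy⟩ : ∃ y : ℓ^p(ℤ, ℂ), y ≠ 0 ∧
      ‖schrodinger p v hv y‖ ≤ 2 * (2 * (C + 1 : ℝ))⁻¹ * ‖y‖ :=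
    hx.exists_norm_schrodinger_le (by positivity) hx0 hxB
  refine lt_irrefl ‖y‖ ?_
  calc ‖y‖ ≤ C * (2 * (2 * (C + 1 : ℝ))⁻¹ * ‖y‖) :=
        (hC y).trans (mul_le_mul_of_nonneg_left hy C.coe_nonneg)
    _ = C / (C + 1) * ‖y‖ := by field_simp
    _ < 1 * ‖y‖ := mul_lt_mul_of_pos_right ((div_lt_one (by positivity)).2 (lt_add_one _))
        (norm_pos_iff.2 hy0)
    _ = ‖y‖ := one_mul _

end WholeLine

section HalfLine

variable {p : ℝ≥0∞} [Fact (1 ≤ p)] {v : ℤ → ℝ} {hv : ∃ C, ∀ n, |v n| ≤ C} {ψ : ℤ → ℂ}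

theorem IsSolution.injective_schrodingerPlus (hψ : IsSolution v ψ)
    (hψ_lim : Tendsto ψ atTop (𝓝 0)) (h : ψ (-1) ≠ 0) :
    Function.Injective (schrodingerPlus p v hv) := by
  rw [injective_iff_map_eq_zero]
  intro x hx
  have hp : p ≠ 0 := (zero_lt_one.trans_le Fact.out).ne'
  have hx_sol : ∀ n, 0 ≤ n → diffExpr v (embed p x) n = 0 := fun n hn => by
    lift n to ℕ using hn
    exact congrFun (congrArg Subtype.val hx) n
  have hx_neg : embed p x (-1) = 0 := rfl
  have hcas : casoratian (embed p x) ψ 0 = 0 :=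
    casoratian_eq_zero_of_tendsto_zero (lp.norm_apply_le_norm hp (embed p x)) hψ_lim
      (hψ_lim.comp (tendsto_atTop_add_const_right atTop (-1) tendsto_id))
      ((eventually_ge_atTop 0).mono fun _ => casoratian_eq_of_nonneg hx_sol fun n _ => hψ n)
  have hx_zero : embed p x 0 = 0 := by
    rw [casoratian, zero_sub, hx_neg, zero_mul, zero_sub, neg_eq_zero] at hcas
    exact (mul_eq_zero_iff_right h).1 hcas
  exact lp.ext (funext (eq_zero_of_diffExpr_eq_zero_of_nonneg hx_sol hx_zero hx_neg))

theorem schrodingerPlus_apply_eq_diffExpr {x : ℓ^p(ℕ, ℂ)} {u : ℤ → ℂ} (hu : u (-1) = 0)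
    (hx : ∀ n : ℕ, x n = u n) (n : ℕ) : schrodingerPlus p v hv x n = diffExpr v u n := by
  have hembed : ∀ m, -1 ≤ m → embed p x m = u m := fun m hm => by
    obtain rfl | hm := hm.eq_or_lt
    · exact hu.symm
    · lift m to ℕ using hm
      exact hx m
  calc schrodingerPlus p v hv x n = diffExpr v (embed p x) n := rfl
    _ = diffExpr v u n := by
      rw [diffExpr, hembed _ (by omega), hembed _ (by omega), hembed _ (by omega), diffExpr]

theorem IsSolution.surjective_schrodingerPlus (hψ : IsSolution v ψ)
    (hψ_sum : Summable fun n : ℕ => ‖ψ n‖) (h : ψ (-1) ≠ 0)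
    (hH : Function.Surjective (schrodinger p v hv)) :
    Function.Surjective (schrodingerPlus p v hv) := fun y => by
  obtain ⟨z, hz⟩ := hH (embed p y)
  -- Correcting `z` by a multiple of the decaying solution enforces the boundary condition at `-1`.
  let c := z (-1) / ψ (-1)
  let u : ℤ → ℂ := fun n => z n - c * ψ n
  have hu_neg : u (-1) = 0 := by
    simp only [u, c, div_mul_cancel₀ _ h, sub_self]
  have hu : ∀ n, diffExpr v u n = diffExpr v z n := fun n => by
    have hcψ := hψ.const_mul c n
    simp only [diffExpr, u] at hcψ ⊢
    linear_combination -hcψ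
  have hu_mem : Memℓp (fun n : ℕ => u n) p :=
    (memlp_comp Nat.cast_injective (lp.memℓp z)).sub ((memlp_of_summable_norm hψ_sum).const_mul c)
  refine ⟨⟨fun n : ℕ => u n, hu_mem⟩, lp.ext (funext fun n => ?_)⟩
  calc schrodingerPlus p v hv ⟨fun n : ℕ => u n, hu_mem⟩ n = diffExpr v u n :=
        schrodingerPlus_apply_eq_diffExpr hu_neg (fun _ => rfl) n
    _ = schrodinger p v hv z n := hu n
    _ = y n := by rw [hz]; rfl

theorem IsSolution.not_injective_schrodingerPlus (hψ : IsSolution v ψ) (hψ0 : ψ ≠ 0)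
    (hψ_sum : Summable fun n : ℕ => ‖ψ n‖) (h : ψ (-1) = 0) :
    ¬ Function.Injective (schrodingerPlus p v hv) := fun hinj => by
  let x : ℓ^p(ℕ, ℂ) := ⟨fun n => ψ n, memlp_of_summable_norm hψ_sum⟩
  have hx : schrodingerPlus p v hv x = 0 := lp.ext <| funext fun n =>
    (schrodingerPlus_apply_eq_diffExpr h (fun _ => rfl) n).trans (hψ n)
  have hx0 : x = 0 := (injective_iff_map_eq_zero _).1 hinj x hx
  exact hψ0 (hψ.eq_zero (congrFun (congrArg Subtype.val hx0) 0) h)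

theorem IsSolution.injective_schrodingerPlus_iff (hψ : IsSolution v ψ) (hψ0 : ψ ≠ 0)
    (hψ_sum : Summable fun n : ℕ => ‖ψ n‖) :
    Function.Injective (schrodingerPlus p v hv) ↔ ψ (-1) ≠ 0 :=
  ⟨fun hinj h => hψ.not_injective_schrodingerPlus hψ0 hψ_sum h hinj,
    hψ.injective_schrodingerPlus (tendsto_atTop_zero_of_summable_norm hψ_sum)⟩

theorem IsSolution.isUnit_schrodingerPlus_iff (hψ : IsSolution v ψ) (hψ0 : ψ ≠ 0)
    (hψ_sum : Summable fun n : ℕ => ‖ψ n‖) (hH : IsUnit (schrodinger p v hv)) :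
    IsUnit (schrodingerPlus p v hv) ↔ ψ (-1) ≠ 0 := by
  have hinj : Function.Injective (schrodingerPlus p v hv) ↔ ψ (-1) ≠ 0 :=
    hψ.injective_schrodingerPlus_iff hψ0 hψ_sum
  rw [ContinuousLinearMap.isUnit_iff_bijective] at hH ⊢
  exact ⟨fun h => hinj.1 h.1,
    fun h => ⟨hinj.2 h, hψ.surjective_schrodingerPlus hψ_sum h hH.2⟩⟩

end HalfLine

section Spectrum

theorem exists_norm_eq_one_add_inv_eq {t : ℝ} (ht : |t| ≤ 2) : ∃ l : ℂ, ‖l‖ = 1 ∧ l + l⁻¹ = t := by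
  obtain ⟨hlower, hupper⟩ := abs_le.1 ht
  let θ : ℝ := Real.arccos (t / 2)
  have hcos : 2 * Complex.cos θ = t := by
    rw [← Complex.ofReal_cos, Real.cos_arccos (by linarith) (by linarith)]
    push_cast
    ring
  refine ⟨Complex.exp (θ * Complex.I), Complex.norm_exp_ofReal_mul_I θ, ?_⟩
  rw [← Complex.exp_neg, ← neg_mul, ← Complex.two_cos, hcos]

theorem exists_abs_lt_one_add_inv_eq {t : ℝ} (ht : 2 < |t|) :
    ∃ l : ℝ, l ≠ 0 ∧ |l| < 1 ∧ l + l⁻¹ = t := by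
  wlog hpos : 0 ≤ t generalizing t
  · obtain ⟨l, hl0, hl, hsum⟩ := this (t := -t) (by rwa [abs_neg]) (by linarith)
    exact ⟨-l, neg_ne_zero.2 hl0, by rwa [abs_neg], by rw [inv_neg]; linarith⟩
  rw [abs_of_nonneg hpos] at ht
  let θ : ℝ := Real.arcosh (t / 2)
  have hθ : 0 < θ := Real.arcosh_pos (by linarith)
  have hcosh : 2 * Real.cosh θ = t := by rw [Real.cosh_arcosh (by linarith)]; ring
  refine ⟨Real.exp (-θ), (Real.exp_pos _).ne', ?_, ?_⟩
  · rwa [Real.abs_exp, Real.exp_lt_one_iff, neg_lt_zero]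
  · rw [← Real.exp_neg, neg_neg, ← hcosh, Real.cosh_eq]
    ring

variable {M : Matrix (Fin 2) (Fin 2) ℝ} {l : ℝ}

theorem charpoly_roots_eq_pair (hdet : M.det = 1) (hl0 : l ≠ 0) (hl : l + l⁻¹ = M.trace) :
    M.charpoly.roots = {l⁻¹, l} := by
  have hfactor : M.charpoly = (({l⁻¹, l} : Multiset ℝ).map fun a => .X - .C a).prod := by
    have hone : (Polynomial.C l⁻¹ * Polynomial.C l : Polynomial ℝ) = 1 := by
      rw [← Polynomial.C_mul, inv_mul_cancel₀ hl0, Polynomial.C_1]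
    rw [Matrix.charpoly_fin_two, hdet, ← hl, Polynomial.C_add, Polynomial.C_1,
      Multiset.insert_eq_cons, Multiset.map_cons, Multiset.map_singleton, Multiset.prod_cons,
      Multiset.prod_singleton]
    linear_combination -hone
  rw [hfactor, Polynomial.roots_multiset_prod_X_sub_C]

theorem hasEigenvector_toLin'_one_zero_iff :
    Module.End.HasEigenvector (Matrix.toLin' M) l ![1, 0] ↔ M 0 0 = l ∧ M 1 0 = 0 := by
  rw [Module.End.hasEigenvector_iff, Module.End.mem_eigenspace_iff, Matrix.toLin'_apply]
  simp [funext_iff, Fin.forall_fin_two]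

theorem hasEigenvector_toLin'_one_zero_iff_abs_lt_one (hdet : M.det = 1)
    (hl0 : l ≠ 0) (hl1 : |l| < 1) (hl : l + l⁻¹ = M.trace) :
    Module.End.HasEigenvector (Matrix.toLin' M) l ![1, 0] ↔ M 1 0 = 0 ∧ |M 0 0| < 1 := by
  rw [hasEigenvector_toLin'_one_zero_iff]
  refine ⟨fun h => ⟨h.2, by rwa [h.1]⟩, fun ⟨h10, h00⟩ => ⟨?_, h10⟩⟩
  rw [Matrix.trace_fin_two] at hl
  rw [Matrix.det_fin_two, h10, mul_zero, sub_zero] at hdet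
  have hroot : (M 0 0 - l) * (M 0 0 - l⁻¹) = 0 := by
    linear_combination mul_inv_cancel₀ hl0 - M 0 0 * hl - hdet
  have hinv : M 0 0 ≠ l⁻¹ := fun h => by
    rw [h, abs_inv] at h00
    exact h00.not_gt ((one_lt_inv₀ (abs_pos.2 hl0)).2 hl1)
  exact sub_eq_zero.1 ((mul_eq_zero_iff_right (sub_ne_zero.2 hinv)).1 hroot)

end Spectrum

section Floquet

variable {K : ℕ} {v : ℤ → ℝ} {φ ψ : ℤ → ℂ}

/-- A Floquet solution with multiplier `l`: a nontrivial solution of `H φ = 0` that is multiplied by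
`l` under translation by the period `K`. -/
structure IsFloquetSolution (v : ℤ → ℝ) (K : ℕ) (l : ℂ) (φ : ℤ → ℂ) : Prop where
  isSolution : IsSolution v φ
  ne_zero : φ ≠ 0
  apply_add_period : ∀ n, φ (n + K) = l * φ n

theorem det_monodromy (v : ℤ → ℝ) (E : ℝ) (k : ℕ) : (monodromy v E k).det = 1 := by
  induction k with
  | zero => exact Matrix.det_one
  | succ k ih => rw [monodromy, Matrix.det_mul, ih, transferMatrix, Matrix.det_fin_two_of]; norm_num

theorem exists_mulVec_eq_smul {M : Matrix (Fin 2) (Fin 2) ℂ} {l : ℂ} (hdet : M.det = 1)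
    (hl0 : l ≠ 0) (hl : l + l⁻¹ = M.trace) : ∃ w ≠ 0, M *ᵥ w = l • w := by
  have hchar : (M - Matrix.scalar (Fin 2) l).det = 0 := by
    rw [Matrix.trace_fin_two] at hl
    rw [Matrix.det_fin_two] at hdet ⊢
    simp only [Matrix.sub_apply, Matrix.scalar_apply, Matrix.diagonal_apply_eq,
      Matrix.diagonal_apply_ne _ zero_ne_one, Matrix.diagonal_apply_ne _ one_ne_zero, sub_zero]
    linear_combination hdet + l * hl - mul_inv_cancel₀ hl0
  obtain ⟨w, hw0, hw⟩ := Matrix.exists_mulVec_eq_zero_iff.2 hchar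
  refine ⟨w, hw0, ?_⟩
  rwa [Matrix.sub_mulVec, Matrix.scalar_apply, ← Matrix.smul_one_eq_diagonal, Matrix.smul_mulVec,
    Matrix.one_mulVec, sub_eq_zero] at hw

theorem exists_isFloquetSolution (hv : Function.Periodic v K) {l : ℂ} (hl0 : l ≠ 0)
    (hl : l + l⁻¹ = (monodromy v 0 K).trace) : ∃ φ, IsFloquetSolution v K l φ := by
  let M : Matrix (Fin 2) (Fin 2) ℂ := (monodromy v 0 K).map (algebraMap ℝ ℂ)
  have hdet : M.det = 1 :=
    ((algebraMap ℝ ℂ).map_det _).symm.trans (by rw [det_monodromy, map_one])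
  have htrace : M.trace = (monodromy v 0 K).trace :=
    (AddMonoidHom.map_trace (algebraMap ℝ ℂ) _).symm
  obtain ⟨w, hw0, hw⟩ := exists_mulVec_eq_smul hdet hl0 (hl.trans htrace.symm)
  obtain ⟨φ, hφ, rfl⟩ := exists_isSolution_initialData_eq v w
  refine ⟨φ, hφ, fun h => hw0 ?_, congrFun (?_ : (fun n => φ (n + K)) = fun n => l * φ n)⟩
  · simp [h, initialData]
  · refine (hφ.comp_add_period hv).eq_of_initialData_eq (hφ.const_mul l) ?_
    calc initialData (fun n => φ (n + K)) 0 = initialData φ K := by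
          simp only [initialData, zero_add, zero_sub, neg_add_eq_sub]
      _ = l • initialData φ 0 := (hφ.initialData_natCast K).trans hw
      _ = initialData (fun n => l * φ n) 0 := by simp [initialData]

theorem exists_pow_eq_of_lt_one {a : ℝ} (ha : 0 < a) (ha1 : a < 1) (hK : 0 < K) :
    ∃ ρ, 0 < ρ ∧ ρ < 1 ∧ a = ρ ^ K :=
  ⟨a ^ (K : ℝ)⁻¹, Real.rpow_pos_of_pos ha _,
    Real.rpow_lt_one ha.le ha1 (inv_pos.2 (Nat.cast_pos.2 hK)),
    (Real.rpow_inv_natCast_pow ha.le hK.ne').symm⟩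

namespace IsFloquetSolution

theorem multiplier_ne_zero {l : ℂ} (hφ : IsFloquetSolution v K l φ) : l ≠ 0 := by
  rintro rfl
  exact hφ.ne_zero (funext fun n => by simpa using hφ.apply_add_period (n - K))

theorem exists_norm_le {l : ℂ} (hφ : IsFloquetSolution v K l φ) (hK : 0 < K) {ρ : ℝ} (hρ : 0 < ρ)
    (hl : ‖l‖ = ρ ^ K) : ∃ C, ∀ n, ‖φ n‖ ≤ C * ρ ^ n := by
  have hperiodic : Function.Periodic (fun n => ‖φ n‖ / ρ ^ n) (K : ℤ) := fun n => by
    simp only [hφ.apply_add_period, norm_mul, hl, zpow_add₀ hρ.ne', zpow_natCast]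
    field_simp
  obtain ⟨C, hC⟩ := bounded_of_periodic hK hperiodic
  exact ⟨C, fun n => (div_le_iff₀ (zpow_pos hρ n)).1 ((le_abs_self _).trans (hC n))⟩

theorem casoratian_ne_zero {l₁ l₂ : ℂ} (hφ : IsFloquetSolution v K l₁ φ)
    (hψ : IsFloquetSolution v K l₂ ψ) (h : l₁ ≠ l₂) : casoratian φ ψ 0 ≠ 0 := fun hcas => by
  obtain ⟨c, rfl⟩ := hφ.isSolution.exists_eq_const_mul hψ.isSolution hψ.ne_zero hcas
  refine hφ.ne_zero (funext fun n => ?_)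
  have hmul := hφ.apply_add_period n
  rw [hψ.apply_add_period] at hmul
  exact (mul_eq_zero_iff_left (sub_ne_zero.2 h)).1 (by linear_combination -hmul)

theorem mulVec_initialData {l : ℂ} (hψ : IsFloquetSolution v K l ψ) :
    (monodromy v 0 K).map (algebraMap ℝ ℂ) *ᵥ initialData ψ 0 = l • initialData ψ 0 := by
  have h0 : ψ K = l * ψ 0 := by simpa only [zero_add] using hψ.apply_add_period 0
  have h1 : ψ (K - 1) = l * ψ (-1) := by
    simpa only [neg_add_eq_sub] using hψ.apply_add_period (-1)
  rw [← hψ.isSolution.initialData_natCast]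
  simp [initialData, h0, h1]

theorem apply_neg_one_eq_zero_iff {l : ℝ} (hψ : IsFloquetSolution v K l ψ) (hl : |l| < 1) :
    ψ (-1) = 0 ↔
      Module.End.HasEigenvector (Matrix.toLin' (monodromy v 0 K)) l ![1, 0] := by
  have hrow : ∀ i, (monodromy v 0 K i 0 : ℂ) * ψ 0 + (monodromy v 0 K i 1 : ℂ) * ψ (-1) =
      l * initialData ψ 0 i := fun i => by
    simpa [initialData, Matrix.mulVec, dotProduct, Fin.sum_univ_two] using
      congrFun hψ.mulVec_initialData i
  rw [hasEigenvector_toLin'_one_zero_iff]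
  refine ⟨fun h => ?_, fun ⟨h00, h10⟩ => ?_⟩
  · have hψ_zero : ψ 0 ≠ 0 := fun h0 => hψ.ne_zero (hψ.isSolution.eq_zero h0 h)
    have h0 : (monodromy v 0 K 0 0 : ℂ) * ψ 0 = l * ψ 0 := by
      simpa [h, initialData] using hrow 0
    have h1 : (monodromy v 0 K 1 0 : ℂ) * ψ 0 = 0 := by
      simpa [h, initialData] using hrow 1
    exact ⟨Complex.ofReal_injective (mul_right_cancel₀ hψ_zero h0),
      Complex.ofReal_eq_zero.1 ((mul_eq_zero_iff_right hψ_zero).1 h1)⟩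
  · -- The remaining diagonal entry is `l⁻¹ ≠ l`, so the eigenvector has no second component.
    have hdet : l * monodromy v 0 K 1 1 = 1 := by
      have h := det_monodromy v 0 K
      rwa [Matrix.det_fin_two, h00, h10, mul_zero, sub_zero] at h
    have hne : monodromy v 0 K 1 1 ≠ l := fun h => by
      rw [h, ← sq] at hdet
      exact ((sq_lt_one_iff_abs_lt_one l).2 hl).ne hdet
    have h1 : (monodromy v 0 K 1 1 : ℂ) * ψ (-1) = l * ψ (-1) := by
      simpa [h10, initialData] using hrow 1
    by_contra hψ_neg
    exact hne (Complex.ofReal_injective (mul_right_cancel₀ hψ_neg h1))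

theorem isUnit_schrodinger {p : ℝ≥0∞} [Fact (1 ≤ p)] {hv : ∃ C, ∀ n, |v n| ≤ C} {l : ℂ}
    (hφ : IsFloquetSolution v K l⁻¹ φ) (hψ : IsFloquetSolution v K l ψ) (hK : 0 < K)
    (hl : ‖l‖ < 1) : IsUnit (schrodinger p v hv) := by
  have hl_pos : 0 < ‖l‖ := norm_pos_iff.2 hψ.multiplier_ne_zero
  obtain ⟨ρ, hρ, hρ1, hρK⟩ := exists_pow_eq_of_lt_one hl_pos hl hK
  obtain ⟨C, hC⟩ := hφ.exists_norm_le hK (inv_pos.2 hρ) (by rw [norm_inv, inv_pow, hρK])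
  obtain ⟨D, hD⟩ := hψ.exists_norm_le hK hρ hρK
  have hne : l⁻¹ ≠ l := fun h => by
    have hinv : 1 < ‖l⁻¹‖ := norm_inv l ▸ (one_lt_inv₀ hl_pos).2 hl
    exact hinv.not_gt ((congrArg norm h).trans_lt hl)
  exact hφ.isSolution.isUnit_schrodinger hψ.isSolution hρ hρ1
    (fun n => (hC n).trans_eq (by rw [inv_zpow'])) hD (hφ.casoratian_ne_zero hψ hne)

theorem not_isUnit_schrodinger {p : ℝ≥0∞} [Fact (1 ≤ p)] {hv : ∃ C, ∀ n, |v n| ≤ C} {l : ℂ}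
    (hφ : IsFloquetSolution v K l φ) (hK : 0 < K) (hl : ‖l‖ = 1) :
    ¬ IsUnit (schrodinger p v hv) := by
  obtain ⟨C, hC⟩ := hφ.exists_norm_le hK one_pos (hl.trans (one_pow K).symm)
  exact hφ.isSolution.not_isUnit_schrodinger hφ.ne_zero fun n => by simpa using hC n

theorem summable_norm {l : ℂ} (hψ : IsFloquetSolution v K l ψ) (hK : 0 < K)
    (hl : ‖l‖ < 1) : Summable fun n : ℕ => ‖ψ n‖ := by
  obtain ⟨ρ, hρ, hρ1, hρK⟩ :=
    exists_pow_eq_of_lt_one (norm_pos_iff.2 hψ.multiplier_ne_zero) hl hK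
  obtain ⟨D, hD⟩ := hψ.exists_norm_le hK hρ hρK
  exact summable_norm_natCast_of_norm_le_zpow hρ.le hρ1 hD

end IsFloquetSolution

theorem isUnit_schrodinger_of_add_inv_eq_trace (hK : 0 < K) (hv : Function.Periodic v K) {l : ℝ}
    (hl0 : l ≠ 0) (hl1 : |l| < 1) (hl : l + l⁻¹ = (monodromy v 0 K).trace) (p : ℝ≥0∞)
    [Fact (1 ≤ p)] : IsUnit (schrodinger p v (bounded_of_periodic hK hv)) := by
  have hl0' : (l : ℂ) ≠ 0 := Complex.ofReal_ne_zero.2 hl0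
  have hl' : (l : ℂ) + (l : ℂ)⁻¹ = (monodromy v 0 K).trace := by exact_mod_cast hl
  obtain ⟨ψ, hψ⟩ := exists_isFloquetSolution hv hl0' hl'
  obtain ⟨φ, hφ⟩ := exists_isFloquetSolution hv (inv_ne_zero hl0') (by rwa [inv_inv, add_comm])
  exact hφ.isUnit_schrodinger hψ hK (by rwa [Complex.norm_real])

theorem isUnit_schrodinger_iff (hK : 0 < K) (hv : Function.Periodic v K) (p : ℝ≥0∞)
    [Fact (1 ≤ p)] : IsUnit (schrodinger p v (bounded_of_periodic hK hv)) ↔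
      2 < |(monodromy v 0 K).trace| := by
  refine ⟨fun hH => ?_, fun htr => ?_⟩
  · by_contra! htr
    obtain ⟨l, hl, hsum⟩ := exists_norm_eq_one_add_inv_eq htr
    obtain ⟨φ, hφ⟩ := exists_isFloquetSolution hv (norm_pos_iff.1 (hl ▸ one_pos)) hsum
    exact hφ.not_isUnit_schrodinger hK hl hH
  · obtain ⟨l, hl0, hl1, hsum⟩ := exists_abs_lt_one_add_inv_eq htr
    exact isUnit_schrodinger_of_add_inv_eq_trace hK hv hl0 hl1 hsum p

theorem exists_isFloquetSolution_summable_norm (hK : 0 < K) (hv : Function.Periodic v K) {l : ℝ}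
    (hl0 : l ≠ 0) (hl1 : |l| < 1) (hl : l + l⁻¹ = (monodromy v 0 K).trace) :
    ∃ ψ, IsFloquetSolution v K l ψ ∧ Summable fun n : ℕ => ‖ψ n‖ := by
  obtain ⟨ψ, hψ⟩ := exists_isFloquetSolution (l := l) hv (Complex.ofReal_ne_zero.2 hl0)
    (by exact_mod_cast hl)
  exact ⟨ψ, hψ, hψ.summable_norm hK (by rwa [Complex.norm_real])⟩

theorem not_injective_schrodingerPlus_iff (hK : 0 < K) (hv : Function.Periodic v K) {l : ℝ}
    (hl0 : l ≠ 0) (hl1 : |l| < 1) (hl : l + l⁻¹ = (monodromy v 0 K).trace) (p : ℝ≥0∞)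
    [Fact (1 ≤ p)] : ¬ Function.Injective (schrodingerPlus p v (bounded_of_periodic hK hv)) ↔
      Module.End.HasEigenvector (Matrix.toLin' (monodromy v 0 K)) l ![1, 0] := by
  obtain ⟨ψ, hψ, hψ_sum⟩ := exists_isFloquetSolution_summable_norm hK hv hl0 hl1 hl
  rw [hψ.isSolution.injective_schrodingerPlus_iff hψ.ne_zero hψ_sum, not_not,
    hψ.apply_neg_one_eq_zero_iff hl1]

theorem not_isUnit_schrodingerPlus_iff (hK : 0 < K) (hv : Function.Periodic v K)
    {l : ℝ} (hl0 : l ≠ 0) (hl1 : |l| < 1) (hl : l + l⁻¹ = (monodromy v 0 K).trace) (p : ℝ≥0∞)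
    [Fact (1 ≤ p)] : ¬ IsUnit (schrodingerPlus p v (bounded_of_periodic hK hv)) ↔
      Module.End.HasEigenvector (Matrix.toLin' (monodromy v 0 K)) l ![1, 0] := by
  obtain ⟨ψ, hψ, hψ_sum⟩ := exists_isFloquetSolution_summable_norm hK hv hl0 hl1 hl
  rw [hψ.isSolution.isUnit_schrodingerPlus_iff hψ.ne_zero hψ_sum
    (isUnit_schrodinger_of_add_inv_eq_trace hK hv hl0 hl1 hl p), not_not,
    hψ.apply_neg_one_eq_zero_iff hl1]

end Floquet

end PeriodicSchrodinger

theorem proposition3p10 (K : ℕ) (hK : 0 < K) (v : ℤ → ℝ) (hv : Function.Periodic v (K : ℤ)) :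
    (∀ (p : ℝ≥0∞) [Fact (1 ≤ p)],
      IsUnit (schrodinger p v (bounded_of_periodic hK hv)) ↔ 2 < |(monodromy v 0 K).trace|) ∧
    (2 < |(monodromy v 0 K).trace| →
      ∃ l₁ l₂ : ℝ, (monodromy v 0 K).charpoly.roots = {l₁, l₂} ∧ |l₂| < 1 ∧ 1 < |l₁| ∧
        List.TFAE [
          ¬ Function.Injective (schrodingerPlus ∞ v (bounded_of_periodic hK hv)),
          ∀ (p : ℝ≥0∞) [Fact (1 ≤ p)],
            ¬ IsUnit (schrodingerPlus p v (bounded_of_periodic hK hv)),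
          ∃ (p : ℝ≥0∞) (_ : Fact (1 ≤ p)),
            ¬ IsUnit (schrodingerPlus p v (bounded_of_periodic hK hv)),
          Module.End.HasEigenvector (Matrix.toLin' (monodromy v 0 K)) l₂ ![1, 0],
          (monodromy v 0 K) 1 0 = 0 ∧ |(monodromy v 0 K) 0 0| < 1]) := by
  refine ⟨isUnit_schrodinger_iff hK hv, fun htr => ?_⟩
  obtain ⟨l, hl0, hl1, hsum⟩ := exists_abs_lt_one_add_inv_eq htr
  have hdet := det_monodromy v 0 K
  refine ⟨l⁻¹, l, charpoly_roots_eq_pair hdet hl0 hsum, hl1,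
    abs_inv l ▸ (one_lt_inv₀ (abs_pos.2 hl0)).2 hl1, ?_⟩
  have hunit := not_isUnit_schrodingerPlus_iff hK hv hl0 hl1 hsum
  tfae_have 1 ↔ 4 := not_injective_schrodingerPlus_iff hK hv hl0 hl1 hsum ∞
  tfae_have 2 → 3 := fun h => ⟨∞, inferInstance, h ∞⟩
  tfae_have 3 → 4 := fun ⟨p, _, h⟩ => (hunit p).1 h
  tfae_have 4 → 2 := fun h p _ => (hunit p).2 h
  tfae_have 4 ↔ 5 := hasEigenvector_toLin'_one_zero_iff_abs_lt_one hdet hl0 hl1 hsum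
  tfae_finish
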